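/- Let $N\in\mathbb N$. A \emph{magic unitary} is a matrix $u\in M_N(\mathcal A)$ over a unital $\mathrm C^*$-algebra whose entries are projections ($u_{ij}=u_{ij}^*=u_{ij}^2$) that sum to $1$ along every row and every column. A \emph{quantum permutation group} $\mathbb G$ on $N$ points is a compact matrix quantum group whose fundamental representation is a magic unitary: a unital $\mathrm C^*$-algebra $C(\mathbb G)$ generated by the entries of a magic unitary $u\in M_N(C(\mathbb G))$ (with $u$ unitary and $u$, $u^t$ invertible) that admits a $*$-homomorphism $\Delta:C(\mathbb G)\to C(\mathbb G)\otimes_{\min}C(\mathbb G)$ with $\Delta(u_{ij})=\sum_{k=1}^N u_{ik}\otimes u_{kj}$. Let $C(S_N^+)$ be the universal $\mathrm C^*$-algebra generated by the entries of an $N\times N$ magic unitary, and let $C(S_N)$ be the algebra of functions on the symmetric group with fundamental representation $(\mathbb 1_{j\to i})_{i,j}$, $\mathbb 1_{j\to i}(\sigma)=\delta_{i,\sigma(j)}$. Write $\mathbb H\subseteq\mathbb G$ if there is a surjective $*$-homomorphism $C(\mathbb G)\to C(\mathbb H)$ mapping the entries of the fundamental representation of $\mathbb G$ to the corresponding entries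 of that of $\mathbb H$, and $\mathbb H\subsetneq\mathbb G$ if moreover there is no $*$-isomorphism $C(\mathbb G)\to C(\mathbb H)$ with this property. \textbf{Theorem.} Let $\mathbb G$ be an exotic quantum permutation group, that is, a quantum permutation group with $S_N\subsetneq\mathbb G\subsetneq S_N^+$, and let $u\in M_N(C(\mathbb G))$ be its fundamental representation. Then $\mathbb G$ has free three-orbitals: for all $a,b,c,d,e,f\in\{1,\dots,N\}$, if $u_{ab}u_{cd}u_{ef}=0$, then it is zero for trivial reasons, that is, two consecutive factors are distinct entries along a common row or column: exactly one of $a=c$, $b=d$ holds, or exactly one of $c=e$, $d=f$ holds. -/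

import Mathlib

open scoped TensorProduct ENNReal

noncomputable section

namespace QuantumPerm

universe u v w

/-! ### Magic unitaries -/

/-- A magic unitary: an `N × N` matrix of (self-adjoint) projections whose rows and columns are
partitions of unity. -/
structure IsMagicUnitary {N : ℕ} {A : Type u} [CStarAlgebra A]
    (a : Matrix (Fin N) (Fin N) A) : Prop where
  isStarProjection : ∀ i j, IsStarProjection (a i j)
  row_sum : ∀ i, ∑ k, a i k = 1
  col_sum : ∀ j, ∑ k, a k j = 1

/-- The unital C⋆-algebra `A` is generated by the entries of the matrix `a`. -/
def IsGeneratedBy {N : ℕ} {A : Type u} [CStarAlgebra A] (a : Matrix (Fin N) (Fin N) A) : Prop :=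
  (StarAlgebra.adjoin ℂ (Set.range fun p : Fin N × Fin N => a p.1 p.2)).topologicalClosure = ⊤

/-! ### The minimal (spatial) tensor product -/

/-- The Hilbert space tensor product of `H` and `K`: the completion of the algebraic tensor product
for the inner product with `⟪x ⊗ y, x' ⊗ y'⟫ = ⟪x, x'⟫ ⟪y, y'⟫`. -/
def HilbertTensor (H : Type u) (K : Type v) [NormedAddCommGroup H] [InnerProductSpace ℂ H]
    [NormedAddCommGroup K] [InnerProductSpace ℂ K] : Type (max u v) :=
  UniformSpace.Completion (H ⊗[ℂ] K)

section Spatial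

variable {H : Type u} {K : Type v} [NormedAddCommGroup H] [InnerProductSpace ℂ H]
  [NormedAddCommGroup K] [InnerProductSpace ℂ K]

instance : NormedAddCommGroup (HilbertTensor H K) :=
  inferInstanceAs (NormedAddCommGroup (UniformSpace.Completion (H ⊗[ℂ] K)))

instance : InnerProductSpace ℂ (HilbertTensor H K) :=
  inferInstanceAs (InnerProductSpace ℂ (UniformSpace.Completion (H ⊗[ℂ] K)))

instance : CompleteSpace (HilbertTensor H K) :=
  inferInstanceAs (CompleteSpace (UniformSpace.Completion (H ⊗[ℂ] K)))

/-- The inclusion of the algebraic tensor product into the Hilbert space tensor product. -/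
def toHilbertTensor : H ⊗[ℂ] K →ₗᵢ[ℂ] HilbertTensor H K :=
  UniformSpace.Completion.toComplₗᵢ

theorem denseRange_toHilbertTensor : DenseRange (toHilbertTensor (H := H) (K := K)) :=
  UniformSpace.Completion.denseRange_coe

/-- The bounded operator `S ⊗ T` on the Hilbert space tensor product, determined by
`(S ⊗ T) (x ⊗ y) = S x ⊗ T y`. -/
def opTensor (S : H →L[ℂ] H) (T : K →L[ℂ] K) : HilbertTensor H K →L[ℂ] HilbertTensor H K :=
  (TensorProduct.mapL S T).completion

theorem opTensor_tmul (S : H →L[ℂ] H) (T : K →L[ℂ] K) (x : H) (y : K) :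
    opTensor S T (toHilbertTensor (x ⊗ₜ[ℂ] y)) = toHilbertTensor (S x ⊗ₜ[ℂ] T y) :=
  ContinuousLinearMap.completion_apply_coe _ _

variable [CompleteSpace H] [CompleteSpace K]
  {A : Type w} {B : Type*} [CStarAlgebra A] [CStarAlgebra B]

/-- For faithful representations `π` of `A` on `H` and `ρ` of `B` on `K`, this is the minimal
tensor product of `A` and `B`: the C⋆-algebra of operators on the Hilbert space tensor product of
`H` and `K` generated by all `π a ⊗ ρ b`. Up to isomorphism it does not depend on the choice of
the faithful representations. -/
def minTensor (π : A →⋆ₐ[ℂ] (H →L[ℂ] H)) (ρ : B →⋆ₐ[ℂ] (K →L[ℂ] K)) :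
    StarSubalgebra ℂ (HilbertTensor H K →L[ℂ] HilbertTensor H K) :=
  (StarAlgebra.adjoin ℂ
    (Set.range fun p : A × B => opTensor (π p.1) (ρ p.2))).topologicalClosure

end Spatial

/-! ### Compact matrix quantum groups -/

/-- There is a ⋆-homomorphism `Δ` from `A` to the minimal tensor product of `A` with itself such
that `Δ (a i j) = ∑ k, a i k ⊗ a k j`. -/
def HasComultiplication {N : ℕ} {A : Type u} [CStarAlgebra A]
    (a : Matrix (Fin N) (Fin N) A) : Prop :=
  ∃ (H : Type u) (_ : NormedAddCommGroup H) (_ : InnerProductSpace ℂ H) (_ : CompleteSpace H)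
    (π : A →⋆ₐ[ℂ] (H →L[ℂ] H)) (_ : Function.Injective π) (Δ : A →⋆ₐ[ℂ] minTensor π π),
    ∀ i j, (Δ (a i j) : HilbertTensor H H →L[ℂ] HilbertTensor H H) =
      ∑ k, opTensor (π (a i k)) (π (a k j))

/-- `A` is the algebra of continuous functions on a compact matrix quantum group with fundamental
representation `a`. -/
structure IsCompactMatrixQuantumGroup {N : ℕ} {A : Type u} [CStarAlgebra A]
    (a : Matrix (Fin N) (Fin N) A) : Prop where
  generated : IsGeneratedBy a
  unitary : a ∈ unitary (Matrix (Fin N) (Fin N) A)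
  isUnit : IsUnit a
  isUnit_transpose : IsUnit a.transpose
  comul : HasComultiplication a

/-- A quantum permutation group on `N` points: a compact matrix quantum group whose fundamental
representation is a magic unitary. -/
structure IsQuantumPermutationGroup {N : ℕ} {A : Type u} [CStarAlgebra A]
    (a : Matrix (Fin N) (Fin N) A) : Prop extends IsCompactMatrixQuantumGroup a where
  magic : IsMagicUnitary a

/-! ### The classical permutation group -/

/-- The fundamental representation of the classical permutation group `S_N`: the matrix with
entries `1_{j → i}`, `1_{j → i} σ = δ_{i, σ j}`, in the algebra of functions on `S_N`. -/
def symFund (N : ℕ) : Matrix (Fin N) (Fin N) (Equiv.Perm (Fin N) → ℂ) :=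
  fun i j σ => if i = σ j then 1 else 0

/-! ### The quantum permutation group `S_N^+` -/

/-- A (nonzero) unital C⋆-algebra together with an `N × N` magic unitary over it. -/
structure MagicModel (N : ℕ) : Type (u + 1) where
  carrier : Type u
  [cstar : CStarAlgebra carrier]
  [nontrivial : Nontrivial carrier]
  mat : Matrix (Fin N) (Fin N) carrier
  magic : IsMagicUnitary mat

attribute [instance] MagicModel.cstar MagicModel.nontrivial

/-- The C⋆-algebra of bounded families `(x_M)`, `x_M ∈ M`, indexed by all magic models `M`. -/
abbrev ModelProduct (N : ℕ) : Type (u + 1) := lp (fun M : MagicModel.{u} N => M.carrier) ∞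

instance (N : ℕ) : CStarAlgebra (ModelProduct.{u} N) where

/-- The tautological magic unitary, whose component at each model is the magic unitary of that
model. -/
def modelMatrix (N : ℕ) : Matrix (Fin N) (Fin N) (ModelProduct.{u} N) := fun i j =>
  ⟨fun M => M.mat i j, memℓp_infty ⟨1, by
    rintro _ ⟨M, rfl⟩
    exact (M.magic.isStarProjection i j).norm_le⟩⟩

/-- The C⋆-algebra `C(S_N^+)`, the universal C⋆-algebra generated by the entries of an `N × N`
magic unitary: the C⋆-algebra generated by the entries of the tautological magic unitary in the
product of all magic models. (Models range over a universe `u`; a C⋆-algebra generated by finitely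
many elements is separable, so up to isomorphism the result does not depend on `u`.) -/
def freeSymAlg (N : ℕ) : StarSubalgebra ℂ (ModelProduct.{u} N) :=
  (StarAlgebra.adjoin ℂ
    (Set.range fun p : Fin N × Fin N => modelMatrix N p.1 p.2)).topologicalClosure

instance (N : ℕ) : CStarAlgebra (freeSymAlg.{u} N) :=
  StarSubalgebra.cstarAlgebra _ (h_closed := StarSubalgebra.isClosed_topologicalClosure _)

/-- The fundamental representation of `S_N^+`. -/
def freeSymFund (N : ℕ) : Matrix (Fin N) (Fin N) (freeSymAlg.{u} N) := fun i j =>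
  ⟨modelMatrix N i j, StarSubalgebra.le_topologicalClosure _
    (StarAlgebra.subset_adjoin ℂ _ ⟨(i, j), rfl⟩)⟩

/-- Evaluation of a bounded family at a model. -/
def evalModel {N : ℕ} (M : MagicModel.{u} N) : ModelProduct.{u} N →⋆ₐ[ℂ] M.carrier where
  toFun x := x M
  map_one' := rfl
  map_mul' _ _ := rfl
  map_zero' := rfl
  map_add' _ _ := rfl
  commutes' _ := rfl
  map_star' _ := rfl

theorem freeSymFund_magic (N : ℕ) : IsMagicUnitary (freeSymFund.{u} N) where
  isStarProjection i j := by
    refine ⟨Subtype.ext (Subtype.ext (funext fun M => ?_)),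
      Subtype.ext (Subtype.ext (funext fun M => ?_))⟩
    · exact (M.magic.isStarProjection i j).isIdempotentElem
    · exact (M.magic.isStarProjection i j).isSelfAdjoint
  row_sum i := by
    refine Subtype.ext (Subtype.ext (funext fun M => ?_))
    have := map_sum ((evalModel M).comp (freeSymAlg N).subtype)
      (fun k => freeSymFund N i k) Finset.univ
    exact this.trans (M.magic.row_sum i)
  col_sum j := by
    refine Subtype.ext (Subtype.ext (funext fun M => ?_))
    have := map_sum ((evalModel M).comp (freeSymAlg N).subtype)
      (fun k => freeSymFund N k j) Finset.univ
    exact this.trans (M.magic.col_sum j)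

theorem freeSymFund_generated (N : ℕ) : IsGeneratedBy (freeSymFund.{u} N) := by
  set S : StarSubalgebra ℂ (freeSymAlg.{u} N) :=
    StarAlgebra.adjoin ℂ (Set.range fun p : Fin N × Fin N => freeSymFund N p.1 p.2) with hS
  have hmap : S.map (freeSymAlg.{u} N).subtype =
      StarAlgebra.adjoin ℂ (Set.range fun p : Fin N × Fin N => modelMatrix N p.1 p.2) := by
    rw [hS, StarAlgHom.map_adjoin, ← Set.range_comp]
    rfl
  refine eq_top_iff.2 fun x _ => ?_
  change x ∈ closure (S : Set (freeSymAlg.{u} N))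
  rw [closure_subtype]
  have hx : (x : ModelProduct.{u} N) ∈ closure
      (StarAlgebra.adjoin ℂ (Set.range fun p : Fin N × Fin N => modelMatrix N p.1 p.2) :
        Set (ModelProduct.{u} N)) := x.2
  rw [← hmap] at hx
  exact hx

/-- The universal property of `C(S_N^+)`. -/
theorem freeSym_universal {N : ℕ} {B : Type u} [CStarAlgebra B] {b : Matrix (Fin N) (Fin N) B}
    (hb : IsMagicUnitary b) :
    ∃! φ : freeSymAlg.{u} N →⋆ₐ[ℂ] B, ∀ i j, φ (freeSymFund N i j) = b i j := by
  have hex : ∃ φ : freeSymAlg.{u} N →⋆ₐ[ℂ] B, ∀ i j, φ (freeSymFund N i j) = b i j := by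
    cases subsingleton_or_nontrivial B
    · exact ⟨{ toFun := fun _ => 0
               map_one' := Subsingleton.elim _ _
               map_mul' := fun _ _ => Subsingleton.elim _ _
               map_zero' := Subsingleton.elim _ _
               map_add' := fun _ _ => Subsingleton.elim _ _
               commutes' := fun _ => Subsingleton.elim _ _
               map_star' := fun _ => Subsingleton.elim _ _ }, fun _ _ => Subsingleton.elim _ _⟩
    · exact ⟨(evalModel ⟨B, b, hb⟩).comp (freeSymAlg N).subtype, fun _ _ => rfl⟩
  obtain ⟨φ, hφ⟩ := hex
  refine ⟨φ, hφ, fun ψ hψ => ?_⟩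
  have hle : StarAlgebra.adjoin ℂ
      (Set.range fun p : Fin N × Fin N => freeSymFund.{u} N p.1 p.2) ≤ StarAlgHom.equalizer ψ φ :=
    StarAlgebra.adjoin_le (by rintro _ ⟨p, rfl⟩; exact (hψ _ _).trans (hφ _ _).symm)
  have hcl : IsClosed (StarAlgHom.equalizer ψ φ : Set (freeSymAlg.{u} N)) :=
    isClosed_eq (AddMonoidHomClass.continuous_of_bound ψ 1 fun x => by
      simpa using NonUnitalStarAlgHom.norm_apply_le ψ x)
      (AddMonoidHomClass.continuous_of_bound φ 1 fun x => by
        simpa using NonUnitalStarAlgHom.norm_apply_le φ x)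
  have htop := StarSubalgebra.topologicalClosure_minimal hle hcl
  have hgen : _ = _ := freeSymFund_generated.{u} N
  rw [hgen] at htop
  exact StarAlgHom.ext fun x => htop (show x ∈ (⊤ : StarSubalgebra ℂ _) from trivial)

/-! ### Quantum subgroups -/

/-- For `a` and `b` the fundamental representations of `ℍ` and `𝔾`, with entries in `A = C(ℍ)` and
`B = C(𝔾)`: the relation `ℍ ⊆ 𝔾`, that is, there is a surjective ⋆-homomorphism `C(𝔾) → C(ℍ)` that
maps the entries of `b` to those of `a`. Being determined on generators, it respects the
comultiplications. -/
def IsQuantumSubgroup {N : ℕ} {A : Type u} {B : Type v} [CStarAlgebra A] [CStarAlgebra B]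
    (a : Matrix (Fin N) (Fin N) A) (b : Matrix (Fin N) (Fin N) B) : Prop :=
  ∃ φ : B →⋆ₐ[ℂ] A, Function.Surjective φ ∧ ∀ i j, φ (b i j) = a i j

/-- The relation `ℍ = 𝔾`: there is a ⋆-isomorphism `C(𝔾) → C(ℍ)` that maps the entries of `b` to
those of `a`. -/
def IsSameQuantumGroup {N : ℕ} {A : Type u} {B : Type v} [CStarAlgebra A] [CStarAlgebra B]
    (a : Matrix (Fin N) (Fin N) A) (b : Matrix (Fin N) (Fin N) B) : Prop :=
  ∃ φ : B ≃⋆ₐ[ℂ] A, ∀ i j, φ (b i j) = a i j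

/-- The relation `ℍ ⊊ 𝔾`. -/
def IsProperQuantumSubgroup {N : ℕ} {A : Type u} {B : Type v} [CStarAlgebra A] [CStarAlgebra B]
    (a : Matrix (Fin N) (Fin N) A) (b : Matrix (Fin N) (Fin N) B) : Prop :=
  IsQuantumSubgroup a b ∧ ¬ IsSameQuantumGroup a b

/-- `𝔾`, with fundamental representation `a`, is an exotic quantum permutation group: a quantum
permutation group with `S_N ⊊ 𝔾 ⊊ S_N^+`. -/
structure IsExotic {N : ℕ} {A : Type u} [CStarAlgebra A] (a : Matrix (Fin N) (Fin N) A) :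
    Prop extends IsQuantumPermutationGroup a where
  sym_lt : IsProperQuantumSubgroup (symFund N) a
  lt_freeSym : IsProperQuantumSubgroup a (freeSymFund.{u} N)

/-! ### Free orbitals -/

/-- Two consecutive factors of the monomial `a_{i_1 j_1} ⋯ a_{i_m j_m}` are distinct entries along
a common row or column. -/
def IsTriviallyZero {N m : ℕ} (i j : Fin m → Fin N) : Prop :=
  ∃ (k : ℕ) (hk : k + 1 < m),
    (i ⟨k, by omega⟩ = i ⟨k + 1, hk⟩ ∧ j ⟨k, by omega⟩ ≠ j ⟨k + 1, hk⟩) ∨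
    (i ⟨k, by omega⟩ ≠ i ⟨k + 1, hk⟩ ∧ j ⟨k, by omega⟩ = j ⟨k + 1, hk⟩)

/-- Free `m`-orbitals: a monomial `a_{i_1 j_1} ⋯ a_{i_m j_m}` is zero for trivial reasons only. -/
def HasFreeOrbitals {N : ℕ} {A : Type u} [CStarAlgebra A] (a : Matrix (Fin N) (Fin N) A)
    (m : ℕ) : Prop :=
  ∀ i j : Fin m → Fin N,
    (List.ofFn fun k => a (i k) (j k)).prod = 0 → IsTriviallyZero i j

end QuantumPerm

end

/-! A forbidden vanishing word forces commutativity. Slicing `Δ` with point evaluations at classical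
permutations translates row and column indices independently by `S_N`, so the vanishing of a word of
length three depends only on which row indices coincide and which column indices coincide
(`mul_eq_zero_of_same_coincidences`). If the two patterns agree, a permutation realises the word and
it is nonzero. A nontrivial zero therefore has, up to transposition, rows `p, q, p` and distinct
columns, and all words of that shape vanish. Inserting `1 = ∑ m, a p m` after `a p r * a q s` then
makes all entries commute (`IsMagicUnitary.commute_of_forall_mul_eq_zero`). By Gelfand duality `𝔾 =
S_N`, contradicting exoticness. -/

namespace QuantumPerm

universe u v

/-! ### Magic unitaries and the commutative case. -/

section MagicUnitary

variable {N : ℕ} {A : Type u} [CStarAlgebra A] {a : Matrix (Fin N) (Fin N) A}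

/-- Projections in a C⋆-algebra that sum to one are pairwise orthogonal. -/
theorem mul_eq_zero_of_sum_eq_one {ι : Type*} [Fintype ι] {p : ι → A}
    (hp : ∀ i, IsStarProjection (p i)) (hsum : ∑ i, p i = 1) {i j : ι} (hij : i ≠ j) :
    p i * p j = 0 := by
  classical
  let _ := CStarAlgebra.spectralOrder A
  let _ := CStarAlgebra.spectralOrderedRing A
  -- The compressions `p j * p k * p j` are positive and sum to `p j`. The term `k = j` is already
  -- `p j`, so all others vanish.
  have hterm : ∀ k, p j * p k * p j = star (p k * p j) * (p k * p j) := fun k => by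
    rw [star_mul, (hp k).isSelfAdjoint.star_eq, (hp j).isSelfAdjoint.star_eq, mul_assoc, mul_assoc,
      ← mul_assoc (p k) (p k), (hp k).isIdempotentElem.eq]
  have hj : ∑ k, p j * p k * p j = p j := by
    rw [← Finset.sum_mul, ← Finset.mul_sum, hsum, mul_one, (hp j).isIdempotentElem.eq]
  rw [← Finset.add_sum_erase _ _ (Finset.mem_univ j), (hp j).isIdempotentElem.eq,
    (hp j).isIdempotentElem.eq, add_eq_left] at hj
  have hz := (Finset.sum_eq_zero_iff_of_nonneg fun k _ => by
    rw [hterm]; exact star_mul_self_nonneg _).1 hj i (Finset.mem_erase.2 ⟨hij, Finset.mem_univ i⟩)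
  rw [hterm] at hz
  exact (CStarRing.star_mul_self_eq_zero_iff _).1 hz

theorem IsMagicUnitary.transpose (ha : IsMagicUnitary a) : IsMagicUnitary a.transpose where
  isStarProjection i j := ha.isStarProjection j i
  row_sum := ha.col_sum
  col_sum := ha.row_sum

theorem IsMagicUnitary.row_mul_eq_zero (ha : IsMagicUnitary a) (i : Fin N) {j k : Fin N}
    (h : j ≠ k) : a i j * a i k = 0 :=
  mul_eq_zero_of_sum_eq_one (ha.isStarProjection i) (ha.row_sum i) h

theorem IsMagicUnitary.col_mul_eq_zero (ha : IsMagicUnitary a) (j : Fin N) {i k : Fin N}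
    (h : i ≠ k) : a i j * a k j = 0 :=
  ha.transpose.row_mul_eq_zero j h

/-- If all words `a i j * a k l * a i m` with `i ≠ k` and pairwise distinct `j`, `l`, `m` vanish,
then the entries of the magic unitary `a` commute. -/
theorem IsMagicUnitary.commute_of_forall_mul_eq_zero (ha : IsMagicUnitary a)
    (h : ∀ i k j l m, i ≠ k → j ≠ l → l ≠ m → j ≠ m → a i j * a k l * a i m = 0)
    (i j k l : Fin N) : Commute (a i j) (a k l) := by
  rcases eq_or_ne i k with rfl | hik
  · rcases eq_or_ne j l with rfl | hjl
    · exact Commute.refl _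
    · exact (ha.row_mul_eq_zero i hjl).trans (ha.row_mul_eq_zero i hjl.symm).symm
  rcases eq_or_ne j l with rfl | hjl
  · exact (ha.col_mul_eq_zero j hik).trans (ha.col_mul_eq_zero j hik.symm).symm
  -- In the expansion along row `i`, the term `m = l` dies by column orthogonality and every other
  -- `m ≠ j` by `h`.
  have key : a i j * a k l = a i j * a k l * a i j := by
    conv_lhs => rw [← mul_one (a i j * a k l), ← ha.row_sum i, Finset.mul_sum]
    refine Finset.sum_eq_single j (fun m _ hm => ?_) fun hj => absurd (Finset.mem_univ j) hj
    rcases eq_or_ne l m with rfl | hlm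
    · rw [mul_assoc, ha.col_mul_eq_zero l hik.symm, mul_zero]
    · exact h i k j l m hik hjl hlm hm.symm
  -- The right side of `key` is self-adjoint, hence so is `a i j * a k l`, which is commutation.
  have hstar := congrArg star key
  simp only [star_mul, (ha.isStarProjection _ _).isSelfAdjoint.star_eq] at hstar
  rw [← mul_assoc, ← key] at hstar
  exact hstar.symm

/-- ⋆-homomorphisms that agree on generators are equal. -/
theorem IsGeneratedBy.starAlgHom_ext (ha : IsGeneratedBy a) {B : Type v} [CStarAlgebra B]
    {φ ψ : A →⋆ₐ[ℂ] B} (h : ∀ i j, φ (a i j) = ψ (a i j)) : φ = ψ := by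
  have hle : StarAlgebra.adjoin ℂ (Set.range fun p : Fin N × Fin N => a p.1 p.2) ≤
      StarAlgHom.equalizer φ ψ :=
    StarAlgebra.adjoin_le (by rintro _ ⟨p, rfl⟩; exact h _ _)
  have hcl : IsClosed (StarAlgHom.equalizer φ ψ : Set A) :=
    isClosed_eq (AddMonoidHomClass.continuous_of_bound φ 1 fun x => by
      simpa using NonUnitalStarAlgHom.norm_apply_le φ x)
      (AddMonoidHomClass.continuous_of_bound ψ 1 fun x => by
        simpa using NonUnitalStarAlgHom.norm_apply_le ψ x)
  have htop := StarSubalgebra.topologicalClosure_minimal hle hcl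
  have hgen : _ = _ := ha
  rw [hgen] at htop
  exact StarAlgHom.ext fun x => htop (show x ∈ (⊤ : StarSubalgebra ℂ _) from trivial)

/-- A C⋆-algebra generated by commuting self-adjoint elements is commutative. -/
theorem IsGeneratedBy.mul_comm (ha : IsGeneratedBy a) (hsa : ∀ i j, IsSelfAdjoint (a i j))
    (h : ∀ i j k l, Commute (a i j) (a k l)) (x y : A) : x * y = y * x := by
  -- Two passes: an element commuting with the generators commutes with everything, so the
  -- generators are central, and hence so is all of `A`. Self-adjointness of `z` covers the
  -- condition on `star z` in the star-centralizer.
  have hcent : ∀ z : A, IsSelfAdjoint z → (∀ i j, Commute z (a i j)) → ∀ w, Commute z w := by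
    intro z hz hza
    have hle : StarAlgebra.adjoin ℂ (Set.range fun p : Fin N × Fin N => a p.1 p.2) ≤
        StarSubalgebra.centralizer ℂ {z} := by
      refine StarAlgebra.adjoin_le ?_
      rintro _ ⟨p, rfl⟩
      refine StarSubalgebra.mem_centralizer_iff ℂ |>.2 ?_
      rintro _ rfl
      exact ⟨hza _ _, by rw [hz.star_eq]; exact hza _ _⟩
    have hcl : IsClosed (StarSubalgebra.centralizer ℂ {z} : Set A) :=
      Set.isClosed_centralizer _
    have htop := StarSubalgebra.topologicalClosure_minimal hle hcl
    have hgen : _ = _ := ha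
    rw [hgen] at htop
    intro w
    exact (StarSubalgebra.mem_centralizer_iff ℂ |>.1
      (htop (show w ∈ (⊤ : StarSubalgebra ℂ _) from trivial)) z rfl).1
  have hle : StarAlgebra.adjoin ℂ (Set.range fun p : Fin N × Fin N => a p.1 p.2) ≤
      StarSubalgebra.centralizer ℂ Set.univ := by
    refine StarAlgebra.adjoin_le ?_
    rintro _ ⟨p, rfl⟩
    refine StarSubalgebra.mem_centralizer_iff ℂ |>.2 fun w _ => ?_
    have := hcent _ (hsa p.1 p.2) (h p.1 p.2)
    exact ⟨(this w).symm, (this (star w)).symm⟩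
  have hcl : IsClosed (StarSubalgebra.centralizer ℂ (Set.univ : Set A) : Set A) :=
    Set.isClosed_centralizer _
  have htop := StarSubalgebra.topologicalClosure_minimal hle hcl
  have hgen : _ = _ := ha
  rw [hgen] at htop
  exact (StarSubalgebra.mem_centralizer_iff ℂ |>.1
    (htop (show y ∈ (⊤ : StarSubalgebra ℂ _) from trivial)) x trivial).1

/-- A character maps a magic unitary to a permutation matrix. -/
theorem IsMagicUnitary.exists_perm_of_character (ha : IsMagicUnitary a) (χ : A →⋆ₐ[ℂ] ℂ) :
    ∃ σ : Equiv.Perm (Fin N), ∀ i j, χ (a i j) = if i = σ j then 1 else 0 := by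
  have hne : ∀ j, ∃ i, χ (a i j) ≠ 0 := fun j => by
    by_contra! hz
    have := congrArg χ (ha.col_sum j)
    simp [map_sum, hz] at this
  choose f hf using hne
  have hone : ∀ j, χ (a (f j) j) = 1 := fun j => by
    have := congrArg χ (ha.isStarProjection (f j) j).isIdempotentElem.eq
    rw [map_mul] at this
    exact mul_right_cancel₀ (hf j) (this.trans (one_mul _).symm)
  have hinj : Function.Injective f := fun j k hjk => by
    by_contra hne
    have := congrArg χ (ha.row_mul_eq_zero (f j) hne)
    rw [map_mul, hone j, hjk, hone k] at this
    simp at this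
  refine ⟨Equiv.ofBijective f (Finite.injective_iff_bijective.1 hinj), fun i j => ?_⟩
  rw [Equiv.ofBijective_apply]
  split_ifs with hij
  · rw [hij, hone]
  · have := congrArg χ (ha.col_mul_eq_zero j hij)
    rwa [map_mul, hone, mul_one, map_zero] at this

/-- Every character of `A` is determined on generators, hence is evaluation at a permutation and
factors through `φ`. An element of the kernel is thus killed by all characters and is zero by
Gelfand. -/
theorem IsMagicUnitary.isSameQuantumGroup_symFund (ha : IsMagicUnitary a) (hgen : IsGeneratedBy a)
    (hsub : IsQuantumSubgroup (symFund N) a) (hcomm : ∀ x y : A, x * y = y * x) :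
    IsSameQuantumGroup (symFund N) a := by
  obtain ⟨φ, hφ, hφa⟩ := hsub
  refine ⟨StarAlgEquiv.ofBijective φ ⟨(injective_iff_map_eq_zero φ).2 fun x hx => ?_, hφ⟩, hφa⟩
  let _ : CommCStarAlgebra A := { ‹CStarAlgebra A› with mul_comm := hcomm }
  refine (injective_iff_map_eq_zero (WeakDual.gelfandTransform ℂ A)).1
    (gelfandTransform_isometry A).injective x (ContinuousMap.ext fun χ => ?_)
  let χ' : A →⋆ₐ[ℂ] ℂ := (χ : A →⋆ₐ[ℂ] ℂ)
  obtain ⟨σ, hσ⟩ := ha.exists_perm_of_character χ'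
  have heq : χ' = (Pi.evalStarAlgHom ℂ (fun _ : Equiv.Perm (Fin N) => ℂ) σ).comp φ :=
    hgen.starAlgHom_ext fun i j => by
      rw [hσ, StarAlgHom.comp_apply, hφa]
      rfl
  have : χ' x = 0 := by
    rw [heq, StarAlgHom.comp_apply, hx, map_zero]
  exact this

end MagicUnitary

/-! ### Slice maps on the spatial tensor product. -/

section Slice

variable {H : Type u} {K : Type v} [NormedAddCommGroup H] [InnerProductSpace ℂ H]
  [NormedAddCommGroup K] [InnerProductSpace ℂ K]

theorem toHilbertTensor_injective : Function.Injective (toHilbertTensor (H := H) (K := K)) :=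
  toHilbertTensor.injective

theorem opTensor_mul (S S' : H →L[ℂ] H) (T T' : K →L[ℂ] K) :
    opTensor S T * opTensor S' T' = opTensor (S * S') (T * T') := by
  refine ContinuousLinearMap.coeFn_injective
    (denseRange_toHilbertTensor.equalizer (by fun_prop) (by fun_prop) (funext fun z => ?_))
  induction z using TensorProduct.induction_on with
  | zero => simp
  | tmul x y => simp [opTensor_tmul]
  | add x y hx hy =>
    simp only [Function.comp_apply, map_add] at hx hy ⊢
    rw [hx, hy]

/-- If an elementary sum of operators on `H ⊗ K` vanishes, then so do its values on pure tensors. -/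
theorem sum_tmul_eq_zero {ι : Type*} [Fintype ι] {S : ι → H →L[ℂ] H} {T : ι → K →L[ℂ] K}
    (h : ∑ i, opTensor (S i) (T i) = 0) (ξ : H) (η : K) : ∑ i, S i ξ ⊗ₜ[ℂ] T i η = 0 := by
  apply toHilbertTensor_injective
  rw [map_sum, map_zero]
  simpa [opTensor_tmul] using congrArg (fun R => R (toHilbertTensor (ξ ⊗ₜ[ℂ] η))) h

variable [CompleteSpace H] [CompleteSpace K] {A : Type*} {B : Type*}
  [CStarAlgebra A] [CStarAlgebra B] {ι : Type*} [Fintype ι]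

/-- Linear functionals on the first factor can be applied to vanishing elementary tensors of
operators in faithful representations. -/
theorem sum_smul_eq_zero_of_sum_tmul_eq_zero {π : A →⋆ₐ[ℂ] (H →L[ℂ] H)}
    {ρ : B →⋆ₐ[ℂ] (K →L[ℂ] K)} (hπ : Function.Injective π) (hρ : Function.Injective ρ)
    {x : ι → A} {y : ι → B} (h : ∀ ξ η, ∑ i, π (x i) ξ ⊗ₜ[ℂ] ρ (y i) η = 0) (χ : A →ₗ[ℂ] ℂ) :
    ∑ i, χ (x i) • y i = 0 := by
  refine (injective_iff_map_eq_zero ρ).1 hρ _ (ContinuousLinearMap.ext fun η => ?_)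
  refine ext_inner_left ℂ fun ζ => ?_
  -- Pairing the second leg with vectors first gives a linear relation in `A` itself, so `χ` need
  -- not be continuous.
  have hslice : ∑ i, inner ℂ ζ (ρ (y i) η) • x i = 0 := by
    refine (injective_iff_map_eq_zero π).1 hπ _ (ContinuousLinearMap.ext fun ξ => ?_)
    have := congrArg ((TensorProduct.rid ℂ H).toLinearMap ∘ₗ
      TensorProduct.map LinearMap.id (innerSL ℂ ζ : K →ₗ[ℂ] ℂ)) (h ξ η)
    simpa [map_sum] using this
  have := congrArg χ hslice
  simpa [map_sum, inner_sum, inner_smul_right, mul_comm] using this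

theorem sum_smul_right_eq_zero {π : A →⋆ₐ[ℂ] (H →L[ℂ] H)} {ρ : B →⋆ₐ[ℂ] (K →L[ℂ] K)}
    (hπ : Function.Injective π) (hρ : Function.Injective ρ) {x : ι → A} {y : ι → B}
    (h : ∑ i, opTensor (π (x i)) (ρ (y i)) = 0) (χ : A →ₗ[ℂ] ℂ) : ∑ i, χ (x i) • y i = 0 :=
  sum_smul_eq_zero_of_sum_tmul_eq_zero hπ hρ (sum_tmul_eq_zero h) χ

/-- The vanishing on pure tensors lives in the algebraic tensor product, where the legs can be
swapped without a flip on the completion. -/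
theorem sum_smul_left_eq_zero {π : A →⋆ₐ[ℂ] (H →L[ℂ] H)} {ρ : B →⋆ₐ[ℂ] (K →L[ℂ] K)}
    (hπ : Function.Injective π) (hρ : Function.Injective ρ) {x : ι → A} {y : ι → B}
    (h : ∑ i, opTensor (π (x i)) (ρ (y i)) = 0) (χ : B →ₗ[ℂ] ℂ) : ∑ i, χ (y i) • x i = 0 := by
  refine sum_smul_eq_zero_of_sum_tmul_eq_zero hρ hπ (fun η ξ => ?_) χ
  simpa [map_sum] using congrArg (TensorProduct.comm ℂ H K) (sum_tmul_eq_zero h ξ η)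

end Slice

/-! ### Translation by classical permutations. -/

section Translation

variable {N : ℕ} {A : Type u} [CStarAlgebra A] {a : Matrix (Fin N) (Fin N) A}

/-- The comultiplication of a vanishing word of length three, in a faithful representation. -/
theorem HasComultiplication.exists_sum_opTensor_eq_zero (ha : HasComultiplication a)
    {i j : Fin 3 → Fin N} (h : a (i 0) (j 0) * a (i 1) (j 1) * a (i 2) (j 2) = 0) :
    ∃ (H : Type u) (_ : NormedAddCommGroup H) (_ : InnerProductSpace ℂ H) (_ : CompleteSpace H)
      (π : A →⋆ₐ[ℂ] (H →L[ℂ] H)), Function.Injective π ∧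
      ∑ p : (Fin N × Fin N) × Fin N,
        opTensor (π (a (i 0) p.1.1 * a (i 1) p.1.2 * a (i 2) p.2))
          (π (a p.1.1 (j 0) * a p.1.2 (j 1) * a p.2 (j 2))) = 0 := by
  obtain ⟨H, _, _, _, π, hπ, Δ, hΔ⟩ := ha
  refine ⟨H, _, _, ‹_›, π, hπ, ?_⟩
  have h0 := congrArg (fun x => (Δ x : HilbertTensor H H →L[ℂ] HilbertTensor H H)) h
  simp only [map_mul, map_zero, MulMemClass.coe_mul, ZeroMemClass.coe_zero, hΔ] at h0
  rw [Fintype.sum_mul_sum, ← Fintype.sum_prod_type', Fintype.sum_mul_sum,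
    ← Fintype.sum_prod_type'] at h0
  simpa only [opTensor_mul, ← map_mul] using h0

/-- The point evaluation of `C(𝔾)` at a classical permutation. -/
theorem IsQuantumSubgroup.exists_character (hsub : IsQuantumSubgroup (symFund N) a)
    (σ : Equiv.Perm (Fin N)) :
    ∃ χ : A →⋆ₐ[ℂ] ℂ, ∀ i j, χ (a i j) = if i = σ j then 1 else 0 := by
  obtain ⟨φ, -, hφ⟩ := hsub
  refine ⟨(Pi.evalStarAlgHom ℂ (fun _ : Equiv.Perm (Fin N) => ℂ) σ).comp φ, fun i j => ?_⟩
  rw [StarAlgHom.comp_apply, hφ]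
  rfl

/-- Translation by classical permutations on the left preserves vanishing words. -/
theorem mul_eq_zero_perm_left (ha : HasComultiplication a)
    (hsub : IsQuantumSubgroup (symFund N) a) {i j : Fin 3 → Fin N}
    (h : a (i 0) (j 0) * a (i 1) (j 1) * a (i 2) (j 2) = 0) (σ : Equiv.Perm (Fin N)) :
    a (σ (i 0)) (j 0) * a (σ (i 1)) (j 1) * a (σ (i 2)) (j 2) = 0 := by
  obtain ⟨H, _, _, _, π, hπ, hsum⟩ := ha.exists_sum_opTensor_eq_zero h
  -- On the first leg `χ (a (i 0) k)` is nonzero exactly when `i 0 = σ⁻¹ k`, that is, `k = σ (i 0)`;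
  -- hence the inverse. A single term of the sum survives.
  obtain ⟨χ, hχ⟩ := hsub.exists_character σ⁻¹
  have h1 := sum_smul_right_eq_zero hπ hπ hsum (χ : A →ₗ[ℂ] ℂ)
  rw [Finset.sum_eq_single ((σ (i 0), σ (i 1)), σ (i 2))] at h1
  · simpa [hχ] using h1
  · rintro ⟨⟨k, l⟩, m⟩ - hne
    have : ¬ (i 0 = σ⁻¹ k ∧ i 1 = σ⁻¹ l ∧ i 2 = σ⁻¹ m) := by
      rintro ⟨h0, h1, h2⟩
      simp [h0, h1, h2] at hne
    by_cases h0 : i 0 = σ⁻¹ k <;> by_cases h1 : i 1 = σ⁻¹ l <;> by_cases h2 : i 2 = σ⁻¹ m <;>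
      simp_all
  · exact fun hn => absurd (Finset.mem_univ _) hn

/-- Translation by classical permutations on the right preserves vanishing words. -/
theorem mul_eq_zero_perm_right (ha : HasComultiplication a)
    (hsub : IsQuantumSubgroup (symFund N) a) {i j : Fin 3 → Fin N}
    (h : a (i 0) (j 0) * a (i 1) (j 1) * a (i 2) (j 2) = 0) (σ : Equiv.Perm (Fin N)) :
    a (i 0) (σ (j 0)) * a (i 1) (σ (j 1)) * a (i 2) (σ (j 2)) = 0 := by
  obtain ⟨H, _, _, _, π, hπ, hsum⟩ := ha.exists_sum_opTensor_eq_zero h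
  obtain ⟨χ, hχ⟩ := hsub.exists_character σ
  have h1 := sum_smul_left_eq_zero hπ hπ hsum (χ : A →ₗ[ℂ] ℂ)
  rw [Finset.sum_eq_single ((σ (j 0), σ (j 1)), σ (j 2))] at h1
  · simpa [hχ] using h1
  · rintro ⟨⟨k, l⟩, m⟩ - hne
    have : ¬ (k = σ (j 0) ∧ l = σ (j 1) ∧ m = σ (j 2)) := by
      rintro ⟨h0, h1, h2⟩
      simp [h0, h1, h2] at hne
    by_cases h0 : k = σ (j 0) <;> by_cases h1 : l = σ (j 1) <;> by_cases h2 : m = σ (j 2) <;>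
      simp_all
  · exact fun hn => absurd (Finset.mem_univ _) hn

end Translation

/-! ### Coincidence patterns of indices. -/

/-- Two families with the same coincidences differ by a permutation. -/
theorem exists_perm_comp_eq {ι α : Type*} [Finite α] {f g : ι → α}
    (h : ∀ k l, f k = f l ↔ g k = g l) : ∃ σ : Equiv.Perm α, ∀ k, σ (f k) = g k := by
  classical
  have := Fintype.ofFinite α
  have hfac : g.FactorsThrough f := fun k l hkl => (h k l).1 hkl
  -- The map `f k ↦ g k` is well defined and injective on the range of `f`, so finiteness extends it
  -- to a bijection. The default `id` off that range plays no role.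
  obtain ⟨σ, hσ⟩ := Set.MapsTo.exists_equiv_extend_of_card_eq (t := (Finset.univ : Finset α))
    (Finset.card_univ).symm (s := Set.range f) (f := Function.extend f g id)
    (fun _ _ => by simp) (by
      rintro _ ⟨k, rfl⟩ _ ⟨l, rfl⟩ hkl
      rw [hfac.extend_apply, hfac.extend_apply] at hkl
      exact (h k l).2 hkl)
  refine ⟨σ.trans (Equiv.subtypeUnivEquiv Finset.mem_univ), fun k => ?_⟩
  exact (hσ _ ⟨k, rfl⟩).trans (hfac.extend_apply _ _)

section FreeOrbitals

variable {N : ℕ} {A : Type u} [CStarAlgebra A] {a : Matrix (Fin N) (Fin N) A}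

/-- All vanishing words with the same coincidences among the indices vanish together. -/
theorem mul_eq_zero_of_same_coincidences (ha : HasComultiplication a)
    (hsub : IsQuantumSubgroup (symFund N) a) {i j i' j' : Fin 3 → Fin N}
    (h : a (i 0) (j 0) * a (i 1) (j 1) * a (i 2) (j 2) = 0)
    (hi : ∀ k l, i k = i l ↔ i' k = i' l) (hj : ∀ k l, j k = j l ↔ j' k = j' l) :
    a (i' 0) (j' 0) * a (i' 1) (j' 1) * a (i' 2) (j' 2) = 0 := by
  obtain ⟨σ, hσ⟩ := exists_perm_comp_eq hi
  obtain ⟨τ, hτ⟩ := exists_perm_comp_eq hj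
  have := mul_eq_zero_perm_right ha hsub (i := fun k => σ (i k))
    (mul_eq_zero_perm_left ha hsub h σ) τ
  simpa only [hσ, hτ] using this

/-- Words of length three realised by a classical permutation do not vanish. -/
theorem mul_ne_zero_of_same_coincidences (hsub : IsQuantumSubgroup (symFund N) a)
    {i j : Fin 3 → Fin N} (hij : ∀ k l, j k = j l ↔ i k = i l) :
    a (i 0) (j 0) * a (i 1) (j 1) * a (i 2) (j 2) ≠ 0 := fun h => by
  obtain ⟨σ, hσ⟩ := exists_perm_comp_eq hij
  obtain ⟨χ, hχ⟩ := hsub.exists_character σ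
  have := congrArg χ h
  simp [hχ, hσ] at this

/-- The entries of an exotic quantum permutation group do not all commute. -/
theorem IsExotic.not_forall_commute (ha : IsExotic a) :
    ¬ ∀ i j k l, Commute (a i j) (a k l) := fun h =>
  ha.sym_lt.2 (ha.magic.isSameQuantumGroup_symFund ha.generated ha.sym_lt.1
    (ha.generated.mul_comm (fun i j => (ha.magic.isStarProjection i j).isSelfAdjoint) h))

end FreeOrbitals

end QuantumPerm

/-! ### Case analysis of a nontrivial zero. -/

open QuantumPerm in
theorem mainTheorem2 {N : ℕ} {A : Type*} [CStarAlgebra A] (a : Matrix (Fin N) (Fin N) A)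
    (ha : QuantumPerm.IsExotic a) : QuantumPerm.HasFreeOrbitals a 3 := by
  intro i j h
  have hsub := ha.sym_lt.1
  by_contra hnt
  have h3 : a (i 0) (j 0) * a (i 1) (j 1) * a (i 2) (j 2) = 0 := by
    simpa [List.ofFn_succ, mul_assoc] using h
  have h01 : i 0 = i 1 ↔ j 0 = j 1 := by
    by_contra hc
    exact hnt ⟨0, by omega, by change (i 0 = i 1 ∧ j 0 ≠ j 1) ∨ (i 0 ≠ i 1 ∧ j 0 = j 1); tauto⟩
  have h12 : i 1 = i 2 ↔ j 1 = j 2 := by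
    by_contra hc
    exact hnt ⟨1, by omega, by change (i 1 = i 2 ∧ j 1 ≠ j 2) ∨ (i 1 ≠ i 2 ∧ j 1 = j 2); tauto⟩
  have h02 : ¬ (i 0 = i 2 ↔ j 0 = j 2) := fun h02 => by
    refine mul_ne_zero_of_same_coincidences hsub (fun k l => ?_) h3
    fin_cases k <;> fin_cases l <;> simp [h01, h12, h02, eq_comm] <;> grind
  -- If two neighbouring rows agreed, so would the columns, and one of `h01`, `h12` would turn the
  -- other into the equivalence denied by `h02`.
  have hi01 : i 0 ≠ i 1 := by grind
  have hi12 : i 1 ≠ i 2 := by grind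
  by_cases hi02 : i 0 = i 2
  · have hj02 : j 0 ≠ j 2 := by tauto
    refine ha.not_forall_commute (ha.magic.commute_of_forall_mul_eq_zero
      fun p q r s t hpq hrs hst hrt => ?_)
    refine mul_eq_zero_of_same_coincidences ha.comul hsub (i' := ![p, q, p]) (j' := ![r, s, t]) h3
      (fun k l => ?_) (fun k l => ?_)
    all_goals fin_cases k <;> fin_cases l <;> simp <;> grind
  -- Here the columns repeat and the rows are distinct, so the commutation argument runs on the
  -- transpose.
  · have hj02 : j 0 = j 2 := by tauto
    refine ha.not_forall_commute fun p q r s =>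
      ha.magic.transpose.commute_of_forall_mul_eq_zero
        (fun p q r s t hpq hrs hst hrt => ?_) q p s r
    refine mul_eq_zero_of_same_coincidences ha.comul hsub (i' := ![r, s, t]) (j' := ![p, q, p]) h3
      (fun k l => ?_) (fun k l => ?_)
    all_goals fin_cases k <;> fin_cases l <;> simp <;> grind
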